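/- **Theorem (Progress for the concurrent Session Abstract Machine).** Let $P$ be a process of CLLB (with cuts annotated as sequential, $\mathsf{cut}$, or concurrent, $\mathsf{pcut}$) such that $P\vdash\emptyset;\emptyset$ and $P$ is live. Then $enc^c(P)$ is defined, and every machine state $S=enc^c(P)$ has a transition $S\Mapsto C$ for some $C$. The notions are as follows. *Types.* $A,B::=\mathbf 1\mid\bot\mid A\otimes B\mid A⅋B\mid\oplus_{\ell\in L}A_\ell\mid\&_{\ell\in L}A_\ell\mid{!A}\mid{?A}$ ($L$ a finite set of labels), with the usual duality $\overline A$. The types $\mathbf 1,\otimes,\oplus,!$ are positive, the others negative. *Processes.* $\mathbf 0$; $P\,\|\,Q$; $\mathsf{fwd}\,x\,y$ (up to symmetry, $x$ of negative and $y$ of positive type); $\mathsf{close}\,x$; $\mathsf{wait}\,x;P$; $\mathsf{case}\,x\{\ell\in L:P_\ell\}$; $\#l\,x;P$; $\mathsf{send}\,x(z.R);P$; $\mathsf{recv}\,x(z{:}\pm);P$; $!x(z);P$; $?x;P$; $\mathsf{call}\,x(z{:}\pm);P$ (where $\pm$ is the polarity of the type of $z$); $\mathsf{cut!}\{z.P\,|x{:}A|\,Q\}$;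 and, up to symmetry, the buffered cuts $\mathsf{cut}\{P\,|\bar x{:}A\,[q]\,y{:}B|\,Q\}$ and $\mathsf{pcut}\{P\,|\bar x{:}A\,[q]\,y{:}B|\,Q\}$, where $P$ holds the write endpoint $x$, $Q$ holds the read endpoint $y$, $A$ is a type or void ($\emptyset$), and $q$ is a finite queue of values $\checkmark$, $\#l$, $\mathsf{clos}(z,R)$, $\mathsf{clos!}(z,R)$. The *actions* are the forwarders and the processes that start with an action prefix ($\mathsf{close}$ to $\mathsf{call}$ in this list). $P$ is *live* if $P=\mathcal C[\mathcal A]$ with $\mathcal A$ an action and the hole of $\mathcal C$ only below mixes, the two sides of linear cuts, and the right side of $\mathsf{cut!}$. *Typing.* $P\vdash\Delta;\Gamma$ is the dyadic system of classical linear logic with mix ($\Delta$ linear, $\Gamma$ unrestricted and shared). Each linear session is either sequential or concurrent. The rules are: - $\mathbf 0\vdash\emptyset;\Gamma$; $P\|Q\vdash\Delta_1,\Delta_2;\Gamma$ if $P\vdash\Delta_1;\Gamma$ and $Q\vdash\Delta_2;\Gamma$; $\mathsf{fwd}\,x\,y\vdash x{:}\overline A,y{:}A;\Gamma$ if $A$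 is positive and $x,y$ are both sequential or both concurrent. - $\mathsf{close}\,x\vdash x{:}\mathbf 1;\Gamma$; $\mathsf{wait}\,x;Q\vdash\Delta,x{:}\bot;\Gamma$ if $Q\vdash\Delta;\Gamma$; $\mathsf{case}\,x\{\ell\in L:P_\ell\}\vdash\Delta,x{:}\&_{\ell\in L}A_\ell;\Gamma$ if $P_\ell\vdash\Delta,x{:}A_\ell;\Gamma$ for all $\ell\in L$; $\#l\,x;Q\vdash\Delta,x{:}\oplus_{\ell\in L}A_\ell;\Gamma$ if $l\in L$ and $Q\vdash\Delta,x{:}A_l;\Gamma$. - $\mathsf{send}\,x(z.P);Q\vdash\Delta_1,\Delta_2,x{:}A\otimes B;\Gamma$ if $P\vdash\Delta_1,z{:}A;\Gamma$ and $Q\vdash\Delta_2,x{:}B;\Gamma$; $\mathsf{recv}\,x(z);Q\vdash\Delta,x{:}A⅋B;\Gamma$ if $Q\vdash\Delta,z{:}A,x{:}B;\Gamma$. - $!x(z);P\vdash x{:}!A;\Gamma$ if $P\vdash z{:}A;\Gamma$; $?x;Q\vdash\Delta,x{:}?A;\Gamma$ if $Q\vdash\Delta;\Gamma,x{:}A$;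 $\mathsf{call}\,x(z);Q\vdash\Delta;\Gamma,x{:}A$ if $Q\vdash\Delta,z{:}A;\Gamma,x{:}A$; $\mathsf{cut!}\{z.P|x{:}A|Q\}\vdash\Delta;\Gamma$ if $P\vdash z{:}A;\Gamma$ and $Q\vdash\Delta;\Gamma,x{:}\overline A$. - Both linear cuts, with $x,y$ sequential for $\mathsf{cut}$ and concurrent for $\mathsf{pcut}$: $\{P|\bar x{:}A\,[\mathsf{nil}]\,y{:}\overline A|Q\}\vdash\Delta_1,\Delta_2;\Gamma$ if $A$ is positive, $P\vdash\Delta_1,x{:}A;\Gamma$ and $Q\vdash\Delta_2,y{:}\overline A;\Gamma$. - Values are enqueued at the right end: from $\{\mathcal A\,|\bar x{:}A'\,[q]\,y{:}B|\,Q\}\vdash\Delta;\Gamma$ infer $\{P\,|\bar x{:}A''\,[q@v]\,y{:}B|\,Q\}\vdash\Delta;\Gamma$, where $(A',\mathcal A;\,A'',v,P)$ is one of $(\mathbf 1,\mathsf{close}\,x;\,\emptyset,\checkmark,\mathbf 0)$, $(T\otimes A,\mathsf{send}\,x(z.R);P;\,A,\mathsf{clos}(z,R),P)$, $(\oplus_{\ell\in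 L}A_\ell,\#l\,x;P;\,A_l,\#l,P)$, $(!A,!x(z);R;\,\emptyset,\mathsf{clos!}(z,R),\mathbf 0)$. In all rules the names $z$ bound by $\mathsf{send}$, $\mathsf{recv}$, $!$, $\mathsf{call}$ and $\mathsf{cut!}$ are sequential. Bound names are fresh for the contexts of their scopes. *Machine.* A state $(T,H)$ is a multiset $T$ of threads $(\mathcal E,P)$, with $\mathcal E$ an environment mapping names to heap references or to values, and a heap $H$ of session records: sequential ones $a\langle q;\mathcal G,Q\rangle b$ (write endpoint $a$, read endpoint $b$, suspended process $Q$ with environment $\mathcal G$) and concurrent ones $a\langle q\rangle b$. Closures in queues carry their environment. Write $a\langle q;\mathcal G,Q\rangle^s b$ for $b\langle q;\mathcal G,Q\rangle a$ if $q=\mathsf{nil}$, and for $a\langle q;\mathcal G,Q\rangle b$ otherwise; likewise $a\langle q\rangle^s b$. Below, $a=\mathcal E(x)$ and $b=\mathcal E(y)$ where a record has these endpoints, and references called new are distinct and unallocated. Transitions of one thread on sequential records: - $(\mathcal E,\mathsf{cut}\{P|\bar x{:}A[q]y{:}B|Q\},H)\Mapsto(\mathcal E[a/x],P,H[a\langle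 q;\mathcal E[b/y],Q\rangle b])$ if $A$ is positive; $\Mapsto(\mathcal E[b/y],Q,H[a\langle q;\mathcal E[a/x],P\rangle b])$ if $A$ is negative; $\Mapsto(\mathcal E[b/y],Q,H[a\langle q;\emptyset,\mathbf 0\rangle b])$ if $A$ is void and $P=\mathbf 0$ ($a,b$ new; the closures in $q$ receive environment $\mathcal E$). $(\mathcal E,\mathsf{cut!}\{z.R|x|P\},H)\Mapsto(\mathcal E[\mathsf{clos!}(z,\mathcal E,R)/x],P,H)$. - Positive actions on the write endpoint $x$ of $a\langle q;\mathcal G,P\rangle b$: $\mathsf{send}\,x(z.R);Q$ and $\#l\,x;Q$ append $\mathsf{clos}(z,\mathcal E,R)$, respectively $\#l$, to $q$ and continue as $(\mathcal E,Q)$; $\mathsf{close}\,x$ and $!x(z);Q$ append $\checkmark$, respectively $\mathsf{clos!}(z,\mathcal E,Q)$, replace the suspended process by $(\emptyset,\mathbf 0)$, and continue as $(\mathcal G,P)$. - A negative action (including $\mathsf{fwd}\,x\,y$, on $x$) on a write endpoint $x$ is suspended: $(\mathcal E,\mathcal A^-(x),H[a\langle q;\mathcal G,Q\rangle b])\Mapsto(\mathcal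 G,Q,H[a\langle q;\mathcal E,\mathcal A^-(x)\rangle b])$. - Negative actions on the read endpoint $y$: $\mathsf{wait}\,y;P$ with $a\langle\checkmark;\emptyset,\mathbf 0\rangle b$ removes the record and continues as $(\mathcal E,P)$; $?y;Q$ with $a\langle v;\emptyset,\mathbf 0\rangle b$, $v=\mathsf{clos!}(z,\mathcal F,R)$, removes the record and continues as $(\mathcal E[v/y],Q)$; $\mathsf{case}\,y\{\ell\in L:Q_\ell\}$ with $a\langle\#l@q;\mathcal G,P\rangle b$, $l\in L$, leaves $a\langle q;\mathcal G,P\rangle^sb$ and continues as $(\mathcal E,Q_l)$; $\mathsf{recv}\,y(w{:}\pm);Q$ with $a\langle\mathsf{clos}(z,\mathcal F,R)@q;\mathcal G,P\rangle b$ leaves $a\langle q;\mathcal G,P\rangle^sb$ and, with $e,f$ new, adds $e\langle\mathsf{nil};\mathcal F[f/z],R\rangle f$ and continues as $(\mathcal E[e/w],Q)$ in case $+$, or adds $e\langle\mathsf{nil};\mathcal E[f/w],Q\rangle f$ and continues as $(\mathcal F[e/z],R)$ in case $-$. - $\mathsf{call}\,y(w{:}\pm);Q$ with $\mathcal E(y)=\mathsf{clos!}(z,\mathcal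 F,R)$ creates a new sequential record and continues in the same way as $\mathsf{recv}$ does. - $(\mathcal E,\mathsf{fwd}\,x\,y,H[c\langle q_1;\mathcal G,Q\rangle a][b\langle q_2;\mathcal F,P\rangle d])\Mapsto(\mathcal F,P,H[c\langle q_2@q_1;\mathcal G,Q\rangle d])$. On concurrent records the rules are the same without suspended processes ($\mathsf{recv}$ still creates a sequential record), except that $\mathsf{close}$, $!$ and $\mathsf{fwd}$ continue as $(\emptyset,\mathbf 0)$, and that there is no suspension rule: a negative action is blocked unless the rule for it applies. Transitions of states: if $(\mathcal E,P,H)\Mapsto(\mathcal E',P',H')$ then $(\{(\mathcal E,P)\}\uplus T,H)\Mapsto(\{(\mathcal E',P')\}\uplus T,H')$; if $(T,H)\Mapsto(T',H')$ then $(\{(\mathcal E,\mathbf 0)\}\uplus T,H)\Mapsto(T',H')$; $(\{(\mathcal E,P\|Q)\}\uplus T,H)\Mapsto(\{(\mathcal E,P),(\mathcal E,Q)\}\uplus T,H)$; and $(\{(\mathcal E,\mathsf{pcut}\{P|\bar x{:}A[q]y{:}B|Q\})\}\uplus T,H)\Mapsto(\{(\mathcal E[a/x],P),(\mathcal E[b/y],Q)\}\uplus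 T,H[a\langle q\rangle b])$ with $a,b$ new. *Encoding.* $enc^c(P)$ is the state, unique up to the choice of new references, reached from $(\{(\emptyset,P)\},\emptyset)$ by executing the static constructs at the top of threads ($\mathsf{cut}$, $\mathsf{cut!}$, $\mathsf{pcut}$ and mix by the rules above, and threads $\mathbf 0$ by deletion) until every remaining thread is an action. -/

import Mathlib

namespace SAM

abbrev Name := ℕ
abbrev Label := ℕ
/-- Heap references (session endpoints). -/
abbrev Ref := ℕ

/-! ### Types -/

/-- Propositions of classical linear logic, with labelled additives indexed by a finite label set. -/
inductive Ty : Type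
  | one : Ty
  | bot : Ty
  | tensor (A B : Ty) : Ty
  | par (A B : Ty) : Ty
  | plus (L : Finset Label) (A : {l // l ∈ L} → Ty) : Ty
  | amp (L : Finset Label) (A : {l // l ∈ L} → Ty) : Ty
  | bang (A : Ty) : Ty
  | whynot (A : Ty) : Ty

/-- Linear negation. -/
def Ty.dual : Ty → Ty
  | .one => .bot
  | .bot => .one
  | .tensor A B => .par A.dual B.dual
  | .par A B => .tensor A.dual B.dual
  | .plus L A => .amp L fun l => (A l).dual
  | .amp L A => .plus L fun l => (A l).dual
  | .bang A => .whynot A.dual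
  | .whynot A => .bang A.dual

inductive Pol : Type
  | pos : Pol
  | neg : Pol

def Ty.pol : Ty → Pol
  | .one => .pos
  | .tensor _ _ => .pos
  | .plus _ _ => .pos
  | .bang _ => .pos
  | .bot => .neg
  | .par _ _ => .neg
  | .amp _ _ => .neg
  | .whynot _ => .neg

/-- Whether a session is sequential (introduced by `cut`, or by communication or a call)
or concurrent (introduced by `pcut`). -/
inductive Mode : Type
  | seq : Mode
  | conc : Mode

/-! ### Processes of CLLB -/

/-- Values stored in the queue of a buffered cut. -/
inductive QVal (α : Type) : Type
  | tick : QVal α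
  | lab (l : Label) : QVal α
  | clos (z : Name) (P : α) : QVal α
  | closB (z : Name) (P : α) : QVal α

/-- CLLB processes. Forwarders and cuts are commutative, so they are recorded in an oriented form:
* `fwd x y` is the forwarder whose first name has negative type and whose second one positive type;
* `cut κ x A q y B P Q` is the buffered cut `cut { x̄ : A [q] y : B } P Q` (for `κ = seq`) or
  `pcut { x̄ : A [q] y : B } P Q` (for `κ = conc`): `P` holds the write endpoint `x` (bound in `P`),
  `Q` holds the read endpoint `y` (bound in `Q`), and `A = none` stands for the void annotation of
  a writer that has terminated. Values are enqueued at the end of `q` and dequeued from its head;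
  neither `x` nor `y` is bound in the closures stored in `q`.
The names received by `recv` and `call` are annotated with the polarity of their type. -/
inductive Proc : Type
  | zero : Proc
  | mix (P Q : Proc) : Proc
  | fwd (x y : Name) : Proc
  | cut (κ : Mode) (x : Name) (A : Option Ty) (q : List (QVal Proc)) (y : Name) (B : Ty)
      (P Q : Proc) : Proc
  | close (x : Name) : Proc
  | wait (x : Name) (P : Proc) : Proc
  | offer (x : Name) (L : Finset Label) (P : {l // l ∈ L} → Proc) : Proc
  | choose (x : Name) (l : Label) (P : Proc) : Proc
  | send (x y : Name) (P Q : Proc) : Proc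
  | recv (x z : Name) (p : Pol) (P : Proc) : Proc
  | bang (x y : Name) (P : Proc) : Proc
  | whynot (x : Name) (P : Proc) : Proc
  | cutB (x : Name) (A : Ty) (y : Name) (P Q : Proc) : Proc
  | call (x z : Name) (p : Pol) (P : Proc) : Proc

/-- Actions: forwarders and action prefixes. -/
inductive IsAction : Proc → Prop
  | fwd {x y} : IsAction (.fwd x y)
  | close {x} : IsAction (.close x)
  | wait {x P} : IsAction (.wait x P)
  | offer {x L P} : IsAction (.offer x L P)
  | choose {x l P} : IsAction (.choose x l P)
  | send {x y P Q} : IsAction (.send x y P Q)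
  | recv {x z p P} : IsAction (.recv x z p P)
  | bang {x y P} : IsAction (.bang x y P)
  | whynot {x P} : IsAction (.whynot x P)
  | call {x z p P} : IsAction (.call x z p P)

/-- `NegOn A x`: `A` is a negative action on `x`. -/
inductive NegOn : Proc → Name → Prop
  | fwd {x y} : NegOn (.fwd x y) x
  | wait {x P} : NegOn (.wait x P) x
  | offer {x L P} : NegOn (.offer x L P) x
  | recv {x z p P} : NegOn (.recv x z p P) x
  | whynot {x P} : NegOn (.whynot x P) x

/-- Live processes: `P = C[A]` with `A` an action and `C` a static context, that is one whose hole
is only below mixes, linear cuts, and the client side of unrestricted cuts. -/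
inductive Live : Proc → Prop
  | act {A} : IsAction A → Live A
  | mixL {P Q} : Live P → Live (.mix P Q)
  | mixR {P Q} : Live Q → Live (.mix P Q)
  | cutL {κ x A q y B P Q} : Live P → Live (.cut κ x A q y B P Q)
  | cutR {κ x A q y B P Q} : Live Q → Live (.cut κ x A q y B P Q)
  | cutB {x A y P Q} : Live Q → Live (.cutB x A y P Q)

/-! ### Typing -/

/-- Typing contexts: partial maps from names. -/
abbrev Ctx (α : Type) : Type := Name → Option α

namespace Ctx

def empty {α : Type} : Ctx α := fun _ => none

/-- `Δ, x : a` (used when `x` is not in the domain of `Δ`). -/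
def cons {α : Type} (Δ : Ctx α) (x : Name) (a : α) : Ctx α := Function.update Δ x (some a)

/-- `Δ₁, Δ₂` (used when the domains are disjoint). -/
def union {α : Type} (Δ₁ Δ₂ : Ctx α) : Ctx α := fun n => (Δ₁ n).or (Δ₂ n)

def Disj {α : Type} (Δ₁ Δ₂ : Ctx α) : Prop := ∀ n, Δ₁ n = none ∨ Δ₂ n = none

end Ctx

/-- Linear contexts: each session with its mode and its type. -/
abbrev LinCtx : Type := Ctx (Mode × Ty)

/-- Unrestricted contexts. -/
abbrev UnrCtx : Type := Ctx Ty

/-- `Typed P Δ Γ` is the CLLB judgement `P ⊢ Δ; Γ`. The linear context `Δ` records the mode of each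
session next to its type: a forwarder only connects two sessions of the same mode, and the sessions
created by communication and by calls are sequential. Bound names are taken fresh for both
contexts of the scope that they extend. -/
inductive Typed : Proc → LinCtx → UnrCtx → Prop
  | zero {Γ : UnrCtx} : Typed .zero Ctx.empty Γ
  | mix {P Q} {Δ₁ Δ₂ : LinCtx} {Γ : UnrCtx} : Typed P Δ₁ Γ → Typed Q Δ₂ Γ →
      Ctx.Disj Δ₁ Δ₂ →
      Typed (.mix P Q) (Δ₁.union Δ₂) Γ
  | fwd {x y κ A} {Γ : UnrCtx} : Ty.pol A = .pos → x ≠ y →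
      Typed (.fwd x y) ((Ctx.empty.cons x (κ, A.dual)).cons y (κ, A)) Γ
  | one {x κ} {Γ : UnrCtx} : Typed (.close x) (Ctx.empty.cons x (κ, .one)) Γ
  | bot {x Q κ} {Δ : LinCtx} {Γ : UnrCtx} : Typed Q Δ Γ → Δ x = none →
      Typed (.wait x Q) (Δ.cons x (κ, .bot)) Γ
  | amp {x L P A κ} {Δ : LinCtx} {Γ : UnrCtx} : Δ x = none →
      (∀ l, Typed (P l) (Δ.cons x (κ, A l)) Γ) →
      Typed (.offer x L P) (Δ.cons x (κ, .amp L A)) Γ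
  | plus {x l Q L A κ} {Δ : LinCtx} {Γ : UnrCtx} (hl : l ∈ L) : Δ x = none →
      Typed Q (Δ.cons x (κ, A ⟨l, hl⟩)) Γ →
      Typed (.choose x l Q) (Δ.cons x (κ, .plus L A)) Γ
  | tensor {x y P Q A B κ} {Δ₁ Δ₂ : LinCtx} {Γ : UnrCtx} :
      Typed P (Δ₁.cons y (.seq, A)) Γ → Typed Q (Δ₂.cons x (κ, B)) Γ →
      Ctx.Disj Δ₁ Δ₂ → Δ₁ y = none → Γ y = none → Δ₁ x = none → Δ₂ x = none →
      Typed (.send x y P Q) ((Δ₁.union Δ₂).cons x (κ, .tensor A B)) Γ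
  | par {x z Q A B κ} {Δ : LinCtx} {Γ : UnrCtx} :
      Typed Q ((Δ.cons z (.seq, A)).cons x (κ, B)) Γ →
      z ≠ x → Δ z = none → Γ z = none → Δ x = none →
      Typed (.recv x z A.pol Q) (Δ.cons x (κ, .par A B)) Γ
  | bang {x y P A κ} {Γ : UnrCtx} : Typed P (Ctx.empty.cons y (.seq, A)) Γ → Γ y = none →
      Typed (.bang x y P) (Ctx.empty.cons x (κ, .bang A)) Γ
  | whynot {x Q A κ} {Δ : LinCtx} {Γ : UnrCtx} : Typed Q Δ (Γ.cons x A) →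
      Δ x = none → Γ x = none →
      Typed (.whynot x Q) (Δ.cons x (κ, .whynot A)) Γ
  | cutB {x y P Q A} {Δ : LinCtx} {Γ : UnrCtx} :
      Typed P (Ctx.empty.cons y (.seq, A)) Γ → Typed Q Δ (Γ.cons x A.dual) →
      Γ y = none → Δ x = none → Γ x = none →
      Typed (.cutB x A y P Q) Δ Γ
  | call {x z Q A} {Δ : LinCtx} {Γ : UnrCtx} : Γ x = some A → Typed Q (Δ.cons z (.seq, A)) Γ →
      Δ z = none → Γ z = none →
      Typed (.call x z A.pol Q) Δ Γ
  | cut {κ x y P Q A} {Δ₁ Δ₂ : LinCtx} {Γ : UnrCtx} : Ty.pol A = .pos →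
      Typed P (Δ₁.cons x (κ, A)) Γ → Typed Q (Δ₂.cons y (κ, A.dual)) Γ →
      Ctx.Disj Δ₁ Δ₂ → Δ₁ x = none → Γ x = none → Δ₂ y = none → Γ y = none →
      Typed (.cut κ x (some A) [] y A.dual P Q) (Δ₁.union Δ₂) Γ
  | cutOne {κ x y q B Q} {Δ : LinCtx} {Γ : UnrCtx} :
      Typed (.cut κ x (some .one) q y B (.close x) Q) Δ Γ →
      Typed (.cut κ x none (q ++ [.tick]) y B .zero Q) Δ Γ
  | cutTensor {κ x y z q A B T R P Q} {Δ : LinCtx} {Γ : UnrCtx} :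
      Typed (.cut κ x (some (.tensor T A)) q y B (.send x z R P) Q) Δ Γ →
      Typed (.cut κ x (some A) (q ++ [.clos z R]) y B P Q) Δ Γ
  | cutPlus {κ x y l q L A B P Q} {Δ : LinCtx} {Γ : UnrCtx} (hl : l ∈ L) :
      Typed (.cut κ x (some (.plus L A)) q y B (.choose x l P) Q) Δ Γ →
      Typed (.cut κ x (some (A ⟨l, hl⟩)) (q ++ [.lab l]) y B P Q) Δ Γ
  | cutBang {κ x y z q A B P Q} {Δ : LinCtx} {Γ : UnrCtx} :
      Typed (.cut κ x (some (.bang A)) q y B (.bang x z P) Q) Δ Γ →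
      Typed (.cut κ x none (q ++ [.closB z P]) y B .zero Q) Δ Γ

/-! ### Machine states -/

/-- Machine values; closures carry an environment, which maps names to references or values. -/
inductive MVal : Type
  | tick : MVal
  | lab (l : Label) : MVal
  | clos (z : Name) (E : Name → Option (Ref ⊕ MVal)) (P : Proc) : MVal
  | closB (z : Name) (E : Name → Option (Ref ⊕ MVal)) (P : Proc) : MVal

abbrev Env : Type := Name → Option (Ref ⊕ MVal)

namespace Env

def empty : Env := fun _ => none

def setRef (E : Env) (x : Name) (a : Ref) : Env := Function.update E x (some (.inl a))

def setVal (E : Env) (x : Name) (v : MVal) : Env := Function.update E x (some (.inr v))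

/-- `E(x)` is the reference `a`. -/
def IsRef (E : Env) (x : Name) (a : Ref) : Prop := E x = some (.inl a)

/-- `E(x)` is the value `v`. -/
def IsVal (E : Env) (x : Name) (v : MVal) : Prop := E x = some (.inr v)

end Env

/-- A queue value of a process, closed by the environment in which the cut is executed. -/
def QVal.load (E : Env) : QVal Proc → MVal
  | .tick => .tick
  | .lab l => .lab l
  | .clos z P => .clos z E P
  | .closB z P => .closB z E P

/-- Session records with write endpoint `a` and read endpoint `b`: sequential ones hold a suspended
process with its environment, concurrent ones do not. -/
inductive Rec : Type
  | seq (a : Ref) (q : List MVal) (E : Env) (P : Proc) (b : Ref) : Rec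
  | conc (a : Ref) (q : List MVal) (b : Ref) : Rec

namespace Rec

def HasEnd : Rec → Ref → Prop
  | .seq a _ _ _ b, c => c = a ∨ c = b
  | .conc a _ b, c => c = a ∨ c = b

/-- The sequential record with its endpoints swapped if the queue is empty. -/
def seqS (a : Ref) (q : List MVal) (E : Env) (P : Proc) (b : Ref) : Rec :=
  match q with
  | [] => .seq b [] E P a
  | _ :: _ => .seq a q E P b

/-- The concurrent record with its endpoints swapped if the queue is empty. -/
def concS (a : Ref) (q : List MVal) (b : Ref) : Rec :=
  match q with
  | [] => .conc b [] a
  | _ :: _ => .conc a q b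

end Rec

/-- A heap, as the collection of its session records. -/
abbrev Heap : Type := Multiset Rec

/-- `a, b = new`: distinct references not allocated in `H`. -/
def New (H : Heap) (a b : Ref) : Prop :=
  a ≠ b ∧ ∀ r ∈ H, ¬ r.HasEnd a ∧ ¬ r.HasEnd b

/-- Concurrent machine states: a multiset of threads (code with its environment) and a heap. -/
abbrev State : Type := Multiset (Env × Proc) × Heap

/-! ### Transitions -/

/-- The execution rules for sequential linear cuts and for unrestricted cuts. If the writer has
positive type it runs and the reader is suspended; if it has negative type, or has terminated, the
reader runs. -/
inductive CutStep : Env → Proc → Heap → Env → Proc → Heap → Prop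
  | pos {E x A q y B P Q H a b} : New H a b → Ty.pol A = .pos →
      CutStep E (.cut .seq x (some A) q y B P Q) H
        (E.setRef x a) P (.seq a (q.map (QVal.load E)) (E.setRef y b) Q b ::ₘ H)
  | neg {E x A q y B P Q H a b} : New H a b → Ty.pol A = .neg →
      CutStep E (.cut .seq x (some A) q y B P Q) H
        (E.setRef y b) Q (.seq a (q.map (QVal.load E)) (E.setRef x a) P b ::ₘ H)
  | void {E x q y B Q H a b} : New H a b →
      CutStep E (.cut .seq x none q y B .zero Q) H
        (E.setRef y b) Q (.seq a (q.map (QVal.load E)) Env.empty .zero b ::ₘ H)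
  | unr {E x A y P Q H} :
      CutStep E (.cutB x A y P Q) H (E.setVal x (.closB y E P)) Q H

/-- Transitions of a single thread: the sequential rules, followed by the rules for actions on
concurrent sessions. -/
inductive ThreadStep : Env → Proc → Heap → Env → Proc → Heap → Prop
  | cut {E P H E' P' H'} : CutStep E P H E' P' H' → ThreadStep E P H E' P' H'
  | one {E x H a q F P b} : E.IsRef x a →
      ThreadStep E (.close x) (.seq a q F P b ::ₘ H)
        F P (.seq a (q ++ [.tick]) Env.empty .zero b ::ₘ H)
  | bot {E y P H a b} : E.IsRef y b →
      ThreadStep E (.wait y P) (.seq a [.tick] Env.empty .zero b ::ₘ H) E P H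
  | fwd {E x y H c q₁ G Q a b q₂ F P d} : E.IsRef x a → E.IsRef y b →
      ThreadStep E (.fwd x y) (.seq c q₁ G Q a ::ₘ .seq b q₂ F P d ::ₘ H)
        F P (.seq c (q₂ ++ q₁) G Q d ::ₘ H)
  | switch {E A x H a q G Q b} : NegOn A x → E.IsRef x a →
      ThreadStep E A (.seq a q G Q b ::ₘ H) G Q (.seq a q E A b ::ₘ H)
  | tensor {E x z R Q H a q G P b} : E.IsRef x a →
      ThreadStep E (.send x z R Q) (.seq a q G P b ::ₘ H)
        E Q (.seq a (q ++ [.clos z E R]) G P b ::ₘ H)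
  | parPos {E y w Q H a z R q G P b e f} {F : Env} : E.IsRef y b →
      New (.seq a (.clos z F R :: q) G P b ::ₘ H) e f →
      ThreadStep E (.recv y w .pos Q) (.seq a (.clos z F R :: q) G P b ::ₘ H)
        (E.setRef w e) Q (.seq e [] (F.setRef z f) R f ::ₘ Rec.seqS a q G P b ::ₘ H)
  | parNeg {E y w Q H a z R q G P b e f} {F : Env} : E.IsRef y b →
      New (.seq a (.clos z F R :: q) G P b ::ₘ H) e f →
      ThreadStep E (.recv y w .neg Q) (.seq a (.clos z F R :: q) G P b ::ₘ H)
        (F.setRef z e) R (.seq e [] (E.setRef w f) Q f ::ₘ Rec.seqS a q G P b ::ₘ H)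
  | plus {E x l Q H a q G P b} : E.IsRef x a →
      ThreadStep E (.choose x l Q) (.seq a q G P b ::ₘ H)
        E Q (.seq a (q ++ [.lab l]) G P b ::ₘ H)
  | amp {E y L Q H a l q G P b} (hl : l ∈ L) : E.IsRef y b →
      ThreadStep E (.offer y L Q) (.seq a (.lab l :: q) G P b ::ₘ H)
        E (Q ⟨l, hl⟩) (Rec.seqS a q G P b ::ₘ H)
  | bang {E x z Q H a q G P b} : E.IsRef x a →
      ThreadStep E (.bang x z Q) (.seq a q G P b ::ₘ H)
        G P (.seq a (q ++ [.closB z E Q]) Env.empty .zero b ::ₘ H)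
  | whynot {E y Q H a z R b} {F : Env} : E.IsRef y b →
      ThreadStep E (.whynot y Q) (.seq a [.closB z F R] Env.empty .zero b ::ₘ H)
        (E.setVal y (.closB z F R)) Q H
  | callPos {E y w Q H z R a b} {F : Env} : E.IsVal y (.closB z F R) → New H a b →
      ThreadStep E (.call y w .pos Q) H
        (E.setRef w a) Q (.seq a [] (F.setRef z b) R b ::ₘ H)
  | callNeg {E y w Q H z R a b} {F : Env} : E.IsVal y (.closB z F R) → New H a b →
      ThreadStep E (.call y w .neg Q) H
        (F.setRef z a) R (.seq a [] (E.setRef w b) Q b ::ₘ H)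
  | oneC {E x H a q b} : E.IsRef x a →
      ThreadStep E (.close x) (.conc a q b ::ₘ H)
        Env.empty .zero (.conc a (q ++ [.tick]) b ::ₘ H)
  | botC {E y P H a b} : E.IsRef y b →
      ThreadStep E (.wait y P) (.conc a [.tick] b ::ₘ H) E P H
  | fwdC {E x y H c q₁ a b q₂ d} : E.IsRef x a → E.IsRef y b →
      ThreadStep E (.fwd x y) (.conc c q₁ a ::ₘ .conc b q₂ d ::ₘ H)
        Env.empty .zero (.conc c (q₂ ++ q₁) d ::ₘ H)
  | tensorC {E x z R Q H a q b} : E.IsRef x a →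
      ThreadStep E (.send x z R Q) (.conc a q b ::ₘ H)
        E Q (.conc a (q ++ [.clos z E R]) b ::ₘ H)
  | parPosC {E y w Q H a z R q b e f} {F : Env} : E.IsRef y b →
      New (.conc a (.clos z F R :: q) b ::ₘ H) e f →
      ThreadStep E (.recv y w .pos Q) (.conc a (.clos z F R :: q) b ::ₘ H)
        (E.setRef w e) Q (.seq e [] (F.setRef z f) R f ::ₘ Rec.concS a q b ::ₘ H)
  | parNegC {E y w Q H a z R q b e f} {F : Env} : E.IsRef y b →
      New (.conc a (.clos z F R :: q) b ::ₘ H) e f →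
      ThreadStep E (.recv y w .neg Q) (.conc a (.clos z F R :: q) b ::ₘ H)
        (F.setRef z e) R (.seq e [] (E.setRef w f) Q f ::ₘ Rec.concS a q b ::ₘ H)
  | plusC {E x l Q H a q b} : E.IsRef x a →
      ThreadStep E (.choose x l Q) (.conc a q b ::ₘ H)
        E Q (.conc a (q ++ [.lab l]) b ::ₘ H)
  | ampC {E y L Q H a l q b} (hl : l ∈ L) : E.IsRef y b →
      ThreadStep E (.offer y L Q) (.conc a (.lab l :: q) b ::ₘ H)
        E (Q ⟨l, hl⟩) (Rec.concS a q b ::ₘ H)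
  | bangC {E x z Q H a q b} : E.IsRef x a →
      ThreadStep E (.bang x z Q) (.conc a q b ::ₘ H)
        Env.empty .zero (.conc a (q ++ [.closB z E Q]) b ::ₘ H)
  | whynotC {E y Q H a z R b} {F : Env} : E.IsRef y b →
      ThreadStep E (.whynot y Q) (.conc a [.closB z F R] b ::ₘ H)
        (E.setVal y (.closB z F R)) Q H

/-- Transitions of the concurrent machine. -/
inductive Step : State → State → Prop
  | run {E P H E' P' H'} {T : Multiset (Env × Proc)} : ThreadStep E P H E' P' H' →
      Step ((E, P) ::ₘ T, H) ((E', P') ::ₘ T, H')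
  | zero {E} {T T' : Multiset (Env × Proc)} {H H'} : Step (T, H) (T', H') →
      Step ((E, .zero) ::ₘ T, H) (T', H')
  | mix {E P Q} {T : Multiset (Env × Proc)} {H : Heap} :
      Step ((E, .mix P Q) ::ₘ T, H) ((E, P) ::ₘ (E, Q) ::ₘ T, H)
  | pcut {E x A q y B P Q} {T : Multiset (Env × Proc)} {H a b} : New H a b →
      Step ((E, .cut .conc x A q y B P Q) ::ₘ T, H)
        ((E.setRef x a, P) ::ₘ (E.setRef y b, Q) ::ₘ T,
          .conc a (q.map (QVal.load E)) b ::ₘ H)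

/-! ### Encoding of processes into concurrent machine states -/

/-- `Encode S C`: starting from `S`, the static constructs (inaction, mix and all cuts) at the top
of the threads are executed until all remaining threads are actions, and this results in `C`. -/
inductive Encode : State → State → Prop
  | nil {H} : Encode (0, H) (0, H)
  | act {E A} {T T' : Multiset (Env × Proc)} {H H'} : IsAction A → Encode (T, H) (T', H') →
      Encode ((E, A) ::ₘ T, H) ((E, A) ::ₘ T', H')
  | zero {E} {T : Multiset (Env × Proc)} {H C} : Encode (T, H) C →
      Encode ((E, .zero) ::ₘ T, H) C
  | mix {E P Q} {T : Multiset (Env × Proc)} {H C} :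
      Encode ((E, P) ::ₘ (E, Q) ::ₘ T, H) C →
      Encode ((E, .mix P Q) ::ₘ T, H) C
  | pcut {E x A q y B P Q} {T : Multiset (Env × Proc)} {H C a b} : New H a b →
      Encode ((E.setRef x a, P) ::ₘ (E.setRef y b, Q) ::ₘ T,
          .conc a (q.map (QVal.load E)) b ::ₘ H) C →
      Encode ((E, .cut .conc x A q y B P Q) ::ₘ T, H) C
  | cut {E P H E' P' H' C} {T : Multiset (Env × Proc)} : CutStep E P H E' P' H' →
      Encode ((E', P') ::ₘ T, H') C →
      Encode ((E, P) ::ₘ T, H) C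

/-- `EncC P C`: `C` is the concurrent machine state `enc^c(P)` (which is determined by `P` up to
the choice of the new references). -/
def EncC (P : Proc) (C : State) : Prop := Encode ({(Env.empty, P)}, 0) C

end SAM

namespace SAM

/-! ### Inversion of the typing of buffered cuts -/

/-! Progress holds because at least one thread of the encoded state can be traced back through the
cuts in such a way that every session it owns is immediately usable. Call a session ready at an
endpoint if its type is positive and the endpoint is the write end of its record, or if its type is
negative, the endpoint is the read end, and the head of the queue is a value that this type
consumes. A typed action whose sessions are all ready, at pairwise different records, and whose
unrestricted names are bound to closures, has a transition (`Typed.fires`). The suspension rule is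
never needed.

Starting from the closed process, such a thread is followed while the static constructs are executed
(`Encode.exists_fires`). At a cut with a positive writer the writer's endpoint is ready. If the
writer is negative or has terminated, inversion of typing (`Typed.cut_inv`) shows that the queue is
non-empty with a head matching the reader's type, so the reader is ready. The sequential machine
runs exactly this side; at a concurrent cut both sides run, and this side is the one to follow while
the other may be blocked.

The side followed need not be the one that witnesses liveness of the cut. It is live anyway, since
it owns an endpoint and a typed process with a non-empty linear context is live (`Typed.live`). The
liveness hypothesis matters only at mixes and unrestricted cuts, which create no linear session.
Finally, encoding only adds records to the heap, so readiness persists to the end. Existence of the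
encoding is a separate structural recursion (`Typed.encodable`). -/

theorem Ctx.cons_self {α : Type} (Δ : Ctx α) (x : Name) (a : α) : Δ.cons x a x = some a := by
  simp [Ctx.cons]

theorem Ctx.cons_of_ne {α : Type} (Δ : Ctx α) {x n : Name} (a : α) (h : n ≠ x) :
    Δ.cons x a n = Δ n := by
  simp [Ctx.cons, h]

/-- `Δ` is a part of `Δ'`. -/
def Ctx.Sub {α : Type} (Δ Δ' : Ctx α) : Prop := ∀ n a, Δ n = some a → Δ' n = some a

theorem Ctx.sub_union_left {α : Type} (Δ₁ Δ₂ : Ctx α) : Δ₁.Sub (Δ₁.union Δ₂) := by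
  intro n a h
  simp [Ctx.union, h]

theorem Ctx.sub_union_right {α : Type} {Δ₁ Δ₂ : Ctx α} (hd : Ctx.Disj Δ₁ Δ₂) :
    Δ₂.Sub (Δ₁.union Δ₂) := by
  intro n a h
  rcases hd n with h' | h'
  · simp [Ctx.union, h, h']
  · simp [h] at h'

/-- `Fits B A q`: the queue `q` is a possible content of the buffer of a session whose reader has
type `B` and whose writer has type `A`, as far as its head is concerned. -/
inductive Fits : Ty → Option Ty → List (QVal Proc) → Prop
  | nil {A : Ty} : A.pol = .pos → Fits A.dual (some A) []
  | tick : Fits .bot none [.tick]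
  | closB {B z P} : Fits (.whynot B) none [.closB z P]
  | clos {T B A z R q} : Fits (.par T B) A (.clos z R :: q)
  | lab {L B A l q} : l ∈ L → Fits (.amp L B) A (.lab l :: q)

/-- The writer and the reader of a typed buffered cut. -/
structure CutInv (κ : Mode) (x : Name) (A : Option Ty) (q : List (QVal Proc)) (y : Name) (B : Ty)
    (P Q : Proc) (Δ : LinCtx) (Γ : UnrCtx) : Prop where
  fits : Fits B A q
  freshWrite : Γ x = none
  freshRead : Γ y = none
  reader : ∃ Δ₂ : LinCtx, Δ₂.Sub Δ ∧ Δ₂ y = none ∧ Typed Q (Δ₂.cons y (κ, B)) Γ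
  void : A = none → P = .zero
  writer : ∀ A', A = some A' →
    ∃ Δ₁ : LinCtx, Δ₁.Sub Δ ∧ Δ₁ x = none ∧ Typed P (Δ₁.cons x (κ, A')) Γ

/-- The enqueuing rules type a cut through the writer as it was before the output. This recovers the
writer after the output; the condition `n ≠ x` makes its remaining context avoid the session itself.
-/
theorem Typed.send_inv {x z R P Δ Γ κ T A} (h : Typed (.send x z R P) Δ Γ)
    (hx : Δ x = some (κ, .tensor T A)) :
    ∃ Δ₂ : LinCtx, (∀ n a, Δ₂ n = some a → n ≠ x ∧ Δ n = some a) ∧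
      Typed P (Δ₂.cons x (κ, A)) Γ := by
  cases h with
  | @tensor _ _ _ _ A' B' κ' Δ₁ Δ₂ _ hR hP hd h1 h2 h3 h4 =>
    rw [Ctx.cons_self] at hx
    simp only [Option.some.injEq, Prod.mk.injEq, Ty.tensor.injEq] at hx
    obtain ⟨rfl, rfl, rfl⟩ := hx
    refine ⟨Δ₂, fun n a hn => ?_, hP⟩
    have hne : n ≠ x := by
      rintro rfl
      simp [h4] at hn
    exact ⟨hne, by rw [Ctx.cons_of_ne _ _ hne]; exact Ctx.sub_union_right hd n a hn⟩

theorem Typed.choose_inv {x l P Δ Γ κ L A} (hl : l ∈ L) (h : Typed (.choose x l P) Δ Γ)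
    (hx : Δ x = some (κ, .plus L A)) :
    ∃ Δ₂ : LinCtx, (∀ n a, Δ₂ n = some a → n ≠ x ∧ Δ n = some a) ∧
      Typed P (Δ₂.cons x (κ, A ⟨l, hl⟩)) Γ := by
  cases h with
  | @plus _ _ _ L' A' κ' Δ' _ hl' h4 hP =>
    rw [Ctx.cons_self] at hx
    simp only [Option.some.injEq, Prod.mk.injEq, Ty.plus.injEq] at hx
    obtain ⟨rfl, rfl, hA⟩ := hx
    cases hA
    refine ⟨Δ', fun n a hn => ?_, hP⟩
    have hne : n ≠ x := by
      rintro rfl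
      simp [h4] at hn
    exact ⟨hne, by rwa [Ctx.cons_of_ne _ _ hne]⟩

/-- Induction on the derivation undoes the enqueuing rules one value at a time down to the cut with
an empty queue. Values enter at the right, so a new value affects the head only if the queue was
empty; then the reader's type is the dual of the writer's type before the output, which determines
the kind of value enqueued. -/
theorem Typed.cut_inv {κ x A q y B P Q Δ Γ} (h : Typed (.cut κ x A q y B P Q) Δ Γ) :
    CutInv κ x A q y B P Q Δ Γ := by
  generalize hC : Proc.cut κ x A q y B P Q = C at h
  induction h generalizing A q P with
  | @cut κ x y P Q A Δ₁ Δ₂ Γ hA hP hQ hd h1 h2 h3 h4 =>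
    cases hC
    refine ⟨.nil hA, h2, h4, ⟨Δ₂, Ctx.sub_union_right hd, h3, hQ⟩, nofun, ?_⟩
    rintro _ ⟨⟩
    exact ⟨Δ₁, Ctx.sub_union_left _ _, h1, hP⟩
  | cutOne _ ih =>
    cases hC
    have I := ih rfl
    refine ⟨?_, I.freshWrite, I.freshRead, I.reader, fun _ => rfl, nofun⟩
    -- Only with an empty queue does the appended value become the head. There `hA` identifies the
    -- reader's type as the dual of `Ty.one`; the cases of a void writer contradict `hA`.
    generalize hA : some Ty.one = A at I
    cases I.fits with
    | nil _ => cases hA; exact .tick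
    | tick => cases hA
    | closB => cases hA
    | clos => exact .clos
    | lab hl => exact .lab hl
  | cutBang _ ih =>
    cases hC
    have I := ih rfl
    refine ⟨?_, I.freshWrite, I.freshRead, I.reader, fun _ => rfl, nofun⟩
    generalize hA : some (Ty.bang _) = A at I
    cases I.fits with
    | nil _ => cases hA; exact .closB
    | tick => cases hA
    | closB => cases hA
    | clos => exact .clos
    | lab hl => exact .lab hl
  | cutTensor _ ih =>
    cases hC
    have I := ih rfl
    refine ⟨?_, I.freshWrite, I.freshRead, I.reader, nofun, ?_⟩
    · generalize hA : some (Ty.tensor _ _) = A at I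
      cases I.fits with
      | nil _ => cases hA; exact .clos
      | tick => cases hA
      | closB => cases hA
      | clos => exact .clos
      | lab hl => exact .lab hl
    · rintro _ ⟨⟩
      obtain ⟨Δ₁, hs, hx, hP⟩ := I.writer _ rfl
      obtain ⟨Δ₂, h2, hP'⟩ := hP.send_inv (Ctx.cons_self _ _ _)
      refine ⟨Δ₂, fun n a hn => ?_, ?_, hP'⟩
      · obtain ⟨hne, hn'⟩ := h2 n a hn
        rw [Ctx.cons_of_ne _ _ hne] at hn'
        exact hs n a hn'
      · by_contra hne
        obtain ⟨a, ha⟩ := Option.ne_none_iff_exists'.1 hne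
        exact (h2 _ a ha).1 rfl
  | cutPlus hl _ ih =>
    cases hC
    have I := ih rfl
    refine ⟨?_, I.freshWrite, I.freshRead, I.reader, nofun, ?_⟩
    · generalize hA : some (Ty.plus _ _) = A at I
      cases I.fits with
      | nil _ => cases hA; exact .lab hl
      | tick => cases hA
      | closB => cases hA
      | clos => exact .clos
      | lab hl => exact .lab hl
    · rintro _ ⟨⟩
      obtain ⟨Δ₁, hs, hx, hP⟩ := I.writer _ rfl
      obtain ⟨Δ₂, h2, hP'⟩ := hP.choose_inv hl (Ctx.cons_self _ _ _)
      refine ⟨Δ₂, fun n a hn => ?_, ?_, hP'⟩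
      · obtain ⟨hne, hn'⟩ := h2 n a hn
        rw [Ctx.cons_of_ne _ _ hne] at hn'
        exact hs n a hn'
      · by_contra hne
        obtain ⟨a, ha⟩ := Option.ne_none_iff_exists'.1 hne
        exact (h2 _ a ha).1 rfl
  | _ => cases hC

/-! ### Liveness and existence of the encoding -/

/-- Inaction is typed only in the empty linear context, so a linear session must lead to an action.
This gives liveness of whichever side of a cut is ready, wherever the action assumed for the whole
cut lies. -/
theorem Typed.live : ∀ {P : Proc} {Δ : LinCtx} {Γ : UnrCtx}, Typed P Δ Γ →
    ∀ {n : Name}, Δ n ≠ none → Live P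
  | .zero, _, _, h, _, hn => by
    cases h
    exact absurd rfl hn
  | .mix P Q, _, _, h, n, hn => by
    cases h with
    | @mix _ _ Δ₁ Δ₂ _ hP hQ hd =>
      by_cases h1 : Δ₁ n = none
      · refine .mixR (hQ.live (n := n) fun h2 => hn ?_)
        simp [Ctx.union, h1, h2]
      · exact .mixL (hP.live h1)
  | .cut _ _ _ _ y _ _ Q, _, _, h, _, _ => by
    -- The reader owns its endpoint `y` whatever the outer context, so the recursion goes to the
    -- reader and `n` plays no role.
    obtain ⟨Δ₂, -, -, hQ⟩ := h.cut_inv.reader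
    exact .cutR (hQ.live (n := y) (by simp [Ctx.cons_self]))
  | .cutB _ _ _ _ Q, _, _, h, _, hn => by
    cases h with
    | cutB _ hQ => exact .cutB (hQ.live hn)
  | .fwd _ _, _, _, _, _, _ => .act .fwd
  | .close _, _, _, _, _, _ => .act .close
  | .wait _ _, _, _, _, _, _ => .act .wait
  | .offer _ _ _, _, _, _, _, _ => .act .offer
  | .choose _ _ _, _, _, _, _, _ => .act .choose
  | .send _ _ _ _, _, _, _, _, _ => .act .send
  | .recv _ _ _ _, _, _, _, _, _ => .act .recv
  | .bang _ _ _, _, _, _, _, _ => .act .bang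
  | .whynot _ _, _, _, _, _, _ => .act .whynot
  | .call _ _ _ _, _, _, _, _, _ => .act .call

theorem exists_new (H : Heap) : ∃ a b, New H a b := by
  have hbound : ∃ m : ℕ, ∀ r ∈ H, ∀ c, r.HasEnd c → c < m := by
    induction H using Multiset.induction_on with
    | empty => exact ⟨0, by simp⟩
    | cons r H ih =>
      obtain ⟨m, hm⟩ := ih
      have hr : ∃ k : ℕ, ∀ c, r.HasEnd c → c < k := by
        cases r with
        | seq a q E P b =>
          exact ⟨a + b + 1, by rintro c (rfl | rfl) <;> first
            | exact Nat.lt_succ_of_le (Nat.le_add_right _ _)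
            | exact Nat.lt_succ_of_le (Nat.le_add_left _ _)⟩
        | conc a q b =>
          exact ⟨a + b + 1, by rintro c (rfl | rfl) <;> first
            | exact Nat.lt_succ_of_le (Nat.le_add_right _ _)
            | exact Nat.lt_succ_of_le (Nat.le_add_left _ _)⟩
      obtain ⟨k, hk⟩ := hr
      refine ⟨m + k, fun s hs c hc => ?_⟩
      rcases Multiset.mem_cons.1 hs with rfl | hs
      · exact (hk c hc).trans_le (Nat.le_add_left _ _)
      · exact (hm s hs c hc).trans_le (Nat.le_add_right _ _)
  obtain ⟨m, hm⟩ := hbound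
  exact ⟨m, m + 1, Nat.ne_of_lt (Nat.lt_succ_self m), fun r hr =>
    ⟨fun h => Nat.lt_irrefl _ (hm r hr _ h),
      fun h => Nat.lt_irrefl _ ((Nat.lt_succ_self m).trans (hm r hr _ h))⟩⟩

/-- The threads `T` can be encoded, starting from any heap. -/
def Encodable (T : Multiset (Env × Proc)) : Prop := ∀ H : Heap, ∃ C, Encode (T, H) C

theorem Encodable.act {T : Multiset (Env × Proc)} (hT : Encodable T) (E : Env) {A : Proc}
    (hA : IsAction A) : Encodable ((E, A) ::ₘ T) := fun H => by
  obtain ⟨C, hC⟩ := hT H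
  exact ⟨_, .act hA hC⟩

/-- Structural recursion on the process, with the remaining threads as a continuation: their
encodability from every heap absorbs the records created on the way. Typing serves to know that a
void writer is inaction, as the sequential rule for void cuts demands. -/
theorem Typed.encodable : ∀ {P : Proc} {Δ : LinCtx} {Γ : UnrCtx}, Typed P Δ Γ →
    ∀ (E : Env) {T : Multiset (Env × Proc)}, Encodable T → Encodable ((E, P) ::ₘ T)
  | .zero, _, _, _, _, _, hT => fun H => by
    obtain ⟨C, hC⟩ := hT H
    exact ⟨C, .zero hC⟩
  | .mix P Q, _, _, h, E, _, hT => fun H => by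
    cases h with
    | mix hP hQ _ =>
      obtain ⟨C, hC⟩ := hP.encodable E (hQ.encodable E hT) H
      exact ⟨C, .mix hC⟩
  | .cut .conc x (some A) q y B P Q, _, _, h, E, _, hT => fun H => by
    obtain ⟨Δ₂, -, -, hQ⟩ := h.cut_inv.reader
    obtain ⟨Δ₁, -, -, hP⟩ := h.cut_inv.writer A rfl
    obtain ⟨a, b, hab⟩ := exists_new H
    obtain ⟨C, hC⟩ := hP.encodable (E.setRef x a) (hQ.encodable (E.setRef y b) hT)
      (.conc a (q.map (QVal.load E)) b ::ₘ H)
    exact ⟨C, .pcut hab hC⟩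
  | .cut .conc x none q y B P Q, _, _, h, E, _, hT => fun H => by
    obtain ⟨Δ₂, -, -, hQ⟩ := h.cut_inv.reader
    obtain rfl := h.cut_inv.void rfl
    obtain ⟨a, b, hab⟩ := exists_new H
    obtain ⟨C, hC⟩ := hQ.encodable (E.setRef y b) hT (.conc a (q.map (QVal.load E)) b ::ₘ H)
    exact ⟨C, .pcut hab (.zero hC)⟩
  | .cut .seq x (some A) q y B P Q, _, _, h, E, _, hT => fun H => by
    obtain ⟨Δ₂, -, -, hQ⟩ := h.cut_inv.reader
    obtain ⟨Δ₁, -, -, hP⟩ := h.cut_inv.writer A rfl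
    obtain ⟨a, b, hab⟩ := exists_new H
    cases hA : A.pol with
    | pos =>
      obtain ⟨C, hC⟩ := hP.encodable (E.setRef x a) hT
        (.seq a (q.map (QVal.load E)) (E.setRef y b) Q b ::ₘ H)
      exact ⟨C, .cut (.pos hab hA) hC⟩
    | neg =>
      obtain ⟨C, hC⟩ := hQ.encodable (E.setRef y b) hT
        (.seq a (q.map (QVal.load E)) (E.setRef x a) P b ::ₘ H)
      exact ⟨C, .cut (.neg hab hA) hC⟩
  | .cut .seq x none q y B P Q, _, _, h, E, _, hT => fun H => by
    obtain ⟨Δ₂, -, -, hQ⟩ := h.cut_inv.reader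
    obtain rfl := h.cut_inv.void rfl
    obtain ⟨a, b, hab⟩ := exists_new H
    obtain ⟨C, hC⟩ := hQ.encodable (E.setRef y b) hT
      (.seq a (q.map (QVal.load E)) Env.empty .zero b ::ₘ H)
    exact ⟨C, .cut (.void hab) hC⟩
  | .cutB x _ y P Q, _, _, h, E, _, hT => fun H => by
    cases h with
    | cutB _ hQ =>
      obtain ⟨C, hC⟩ := hQ.encodable (E.setVal x (.closB y E P)) hT H
      exact ⟨C, .cut .unr hC⟩
  | .fwd _ _, _, _, _, E, _, hT => hT.act E .fwd
  | .close _, _, _, _, E, _, hT => hT.act E .close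
  | .wait _ _, _, _, _, E, _, hT => hT.act E .wait
  | .offer _ _ _, _, _, _, E, _, hT => hT.act E .offer
  | .choose _ _ _, _, _, _, E, _, hT => hT.act E .choose
  | .send _ _ _ _, _, _, _, E, _, hT => hT.act E .send
  | .recv _ _ _ _, _, _, _, E, _, hT => hT.act E .recv
  | .bang _ _ _, _, _, _, E, _, hT => hT.act E .bang
  | .whynot _ _, _, _, _, E, _, hT => hT.act E .whynot
  | .call _ _ _ _, _, _, _, E, _, hT => hT.act E .call

/-! ### Actions on ready sessions -/

/-- `Ready κ A c r`: an action of mode `κ` and type `A` at the endpoint `c` of `r` is enabled.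
Positive types live at write endpoints, negative ones at read endpoints of non-empty queues. -/
inductive Ready : Mode → Ty → Ref → Rec → Prop
  | write {A c q G P b} : Ty.pol A = .pos → Ready .seq A c (.seq c q G P b)
  | bot {a c} : Ready .seq .bot c (.seq a [.tick] Env.empty .zero c)
  | whynot {A a c z R} {F : Env} :
      Ready .seq (.whynot A) c (.seq a [.closB z F R] Env.empty .zero c)
  | par {A B a c z R q G P} {F : Env} : Ready .seq (.par A B) c (.seq a (.clos z F R :: q) G P c)
  | amp {L A a c l q G P} : l ∈ L → Ready .seq (.amp L A) c (.seq a (.lab l :: q) G P c)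
  | writeC {A c q b} : Ty.pol A = .pos → Ready .conc A c (.conc c q b)
  | botC {a c} : Ready .conc .bot c (.conc a [.tick] c)
  | whynotC {A a c z R} {F : Env} : Ready .conc (.whynot A) c (.conc a [.closB z F R] c)
  | parC {A B a c z R q} {F : Env} : Ready .conc (.par A B) c (.conc a (.clos z F R :: q) c)
  | ampC {L A a c l q} : l ∈ L → Ready .conc (.amp L A) c (.conc a (.lab l :: q) c)

/-- Positive actions and forwarders depend on the position of the endpoint in the record but not on
the contents of the queue. -/
theorem Ready.of_pos {κ A c r} (h : Ready κ A c r) (hA : A.pol = .pos) :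
    (κ = .seq ∧ ∃ q G P b, r = .seq c q G P b) ∨ (κ = .conc ∧ ∃ q b, r = .conc c q b) := by
  cases h <;> first | cases hA | simp

theorem Ready.of_neg {κ A c r} (h : Ready κ A c r) (hA : A.pol = .neg) :
    (κ = .seq ∧ ∃ a q G P, r = .seq a q G P c) ∨ (κ = .conc ∧ ∃ a q, r = .conc a q c) := by
  cases h <;> simp_all

theorem Ty.pol_dual {A : Ty} (h : A.pol = .pos) : A.dual.pol = .neg := by
  cases A <;> simp_all [Ty.pol, Ty.dual]

/-- The environment `E` provides a closure for each name of `Γ`, and pairwise different ready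
records of the heap for the names of `Δ`. -/
structure EnvReady (E : Env) (Δ : LinCtx) (Γ : UnrCtx) (H : Heap) (ρ : Name → Rec) : Prop where
  unr : ∀ x A, Γ x = some A → ∃ z F R, E.IsVal x (.closB z F R)
  lin : ∀ x κ A, Δ x = some (κ, A) → ρ x ∈ H ∧ ∃ c, E.IsRef x c ∧ Ready κ A c (ρ x)
  inj : ∀ x y, x ≠ y → Δ x ≠ none → Δ y ≠ none → ρ x ≠ ρ y

theorem EnvReady.mono {E : Env} {Δ Δ' : LinCtx} {Γ : UnrCtx} {H H' : Heap} {ρ : Name → Rec}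
    (h : EnvReady E Δ Γ H ρ) (hΔ : Δ'.Sub Δ) (hH : H ⊆ H') : EnvReady E Δ' Γ H' ρ where
  unr := h.unr
  lin x κ A hx := (h.lin x κ A (hΔ _ _ hx)).imp_left fun hm => hH hm
  inj x y hne hx hy := by
    obtain ⟨a, ha⟩ := Option.ne_none_iff_exists'.1 hx
    obtain ⟨b, hb⟩ := Option.ne_none_iff_exists'.1 hy
    exact h.inj x y hne (by simp [hΔ _ _ ha]) (by simp [hΔ _ _ hb])

/-- As `x` is fresh for `Γ`, the new reference overwrites no closure. As `r` is not in the old heap,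
it differs from all records already assigned. -/
theorem EnvReady.cons {E : Env} {Δ : LinCtx} {Γ : UnrCtx} {H : Heap} {ρ : Name → Rec}
    (h : EnvReady E Δ Γ H ρ) {x : Name} {κ : Mode} {A : Ty} {c : Ref} {r : Rec}
    (hx : Γ x = none) (hr : Ready κ A c r) (hnew : r ∉ H) :
    EnvReady (E.setRef x c) (Δ.cons x (κ, A)) Γ (r ::ₘ H) (Function.update ρ x r) where
  unr y B hy := by
    have hne : y ≠ x := by
      rintro rfl
      simp [hx] at hy
    simpa [Env.IsVal, Env.setRef, hne] using h.unr y B hy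
  lin y κ' B hy := by
    by_cases hne : y = x
    · subst hne
      rw [Ctx.cons_self] at hy
      cases hy
      simpa [Env.IsRef, Env.setRef] using hr
    · rw [Ctx.cons_of_ne _ _ hne] at hy
      obtain ⟨h1, h2⟩ := h.lin y κ' B hy
      simpa [Env.IsRef, Env.setRef, hne, h1] using h2
  inj y z hne hy hz := by
    have hmem : ∀ n, Δ n ≠ none → ρ n ≠ r := by
      rintro n hn rfl
      obtain ⟨⟨κ', B⟩, hB⟩ := Option.ne_none_iff_exists'.1 hn
      exact hnew (h.lin n κ' B hB).1
    by_cases h1 : y = x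
    · subst h1
      rw [Ctx.cons_of_ne _ _ hne.symm] at hz
      simpa [hne.symm] using (hmem z hz).symm
    · rw [Ctx.cons_of_ne _ _ h1] at hy
      by_cases h2 : z = x
      · subst h2
        simpa [h1] using hmem y hy
      · rw [Ctx.cons_of_ne _ _ h2] at hz
        simpa [h1, h2] using h.inj y z hne hy hz

theorem EnvReady.consUnr {E : Env} {Δ : LinCtx} {Γ : UnrCtx} {H : Heap} {ρ : Name → Rec}
    (h : EnvReady E Δ Γ H ρ) {x : Name} (hx : Δ x = none) (A : Ty) (z : Name) (F : Env)
    (R : Proc) : EnvReady (E.setVal x (.closB z F R)) Δ (Γ.cons x A) H ρ where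
  unr y B hy := by
    by_cases hne : y = x
    · subst hne
      exact ⟨z, F, R, by simp [Env.IsVal, Env.setVal]⟩
    · rw [Ctx.cons_of_ne _ _ hne] at hy
      simpa [Env.IsVal, Env.setVal, hne] using h.unr y B hy
  lin y κ B hy := by
    have hne : y ≠ x := by
      rintro rfl
      simp [hx] at hy
    simpa [Env.IsRef, Env.setVal, hne] using h.lin y κ B hy
  inj := h.inj

/-- The thread `(E, P)` has a transition with the heap `H`. -/
def Fires (E : Env) (P : Proc) (H : Heap) : Prop := ∃ E' P' H', ThreadStep E P H E' P' H'

/-- Each prefix acts on one session, and readiness of that session is precisely the premise of its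
sequential or concurrent rule. Only the forwarder needs two records at once, which is why readiness
of an environment includes injectivity. -/
theorem Typed.fires {A : Proc} {E : Env} {Δ : LinCtx} {Γ : UnrCtx} {H : Heap} {ρ : Name → Rec}
    (hA : IsAction A) (h : Typed A Δ Γ) (hE : EnvReady E Δ Γ H ρ) : Fires E A H := by
  have lin : ∀ {x κ B} {Δ' : LinCtx}, Δ = Δ'.cons x (κ, B) →
      ∃ r H' c, H = r ::ₘ H' ∧ E.IsRef x c ∧ Ready κ B c r := by
    rintro x κ B Δ' rfl
    obtain ⟨hm, c, hc, hr⟩ := hE.lin x κ B (Ctx.cons_self _ _ _)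
    obtain ⟨H', hH⟩ := Multiset.exists_cons_of_mem hm
    exact ⟨_, H', c, hH, hc, hr⟩
  cases h with
  | zero => cases hA
  | mix => cases hA
  | cutB => cases hA
  | cut => cases hA
  | cutOne => cases hA
  | cutTensor => cases hA
  | cutPlus => cases hA
  | cutBang => cases hA
  | @fwd x y κ A _ hpos hne =>
    have hx : ((Ctx.empty.cons x (κ, A.dual)).cons y (κ, A) : LinCtx) x = some (κ, A.dual) := by
      rw [Ctx.cons_of_ne _ _ hne, Ctx.cons_self]
    have hy : ((Ctx.empty.cons x (κ, A.dual)).cons y (κ, A) : LinCtx) y = some (κ, A) :=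
      Ctx.cons_self _ _ _
    obtain ⟨hmx, c, hc, hrx⟩ := hE.lin _ _ _ hx
    obtain ⟨hmy, d, hd, hry⟩ := hE.lin _ _ _ hy
    have hxy := hE.inj x y hne (by simp [hx]) (by simp [hy])
    obtain ⟨H₁, rfl⟩ := Multiset.exists_cons_of_mem hmx
    -- The two records differ, so the second is still present after the first is split off the heap.
    obtain ⟨H₂, rfl⟩ := Multiset.exists_cons_of_mem
      ((Multiset.mem_cons.1 hmy).resolve_left hxy.symm)
    -- Both names of a forwarder have the same mode, so `h1` refutes the combinations of a
    -- sequential with a concurrent record.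
    rcases hrx.of_neg (Ty.pol_dual hpos) with ⟨rfl, a, q, G, P, hρ⟩ | ⟨rfl, a, q, hρ⟩ <;>
      rcases hry.of_pos hpos with ⟨h1, q', G', P', b, hρ'⟩ | ⟨h1, q', b, hρ'⟩ <;> cases h1 <;>
      rw [hρ, hρ']
    · exact ⟨_, _, _, .fwd hc hd⟩
    · exact ⟨_, _, _, .fwdC hc hd⟩
  | one =>
    obtain ⟨r, H', c, rfl, hc, hr⟩ := lin rfl
    rcases hr.of_pos rfl with ⟨rfl, q, G, P, b, rfl⟩ | ⟨rfl, q, b, rfl⟩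
    · exact ⟨_, _, _, .one hc⟩
    · exact ⟨_, _, _, .oneC hc⟩
  | plus =>
    obtain ⟨r, H', c, rfl, hc, hr⟩ := lin rfl
    rcases hr.of_pos rfl with ⟨rfl, q, G, P, b, rfl⟩ | ⟨rfl, q, b, rfl⟩
    · exact ⟨_, _, _, .plus hc⟩
    · exact ⟨_, _, _, .plusC hc⟩
  | tensor =>
    obtain ⟨r, H', c, rfl, hc, hr⟩ := lin rfl
    rcases hr.of_pos rfl with ⟨rfl, q, G, P, b, rfl⟩ | ⟨rfl, q, b, rfl⟩
    · exact ⟨_, _, _, .tensor hc⟩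
    · exact ⟨_, _, _, .tensorC hc⟩
  | bang =>
    obtain ⟨r, H', c, rfl, hc, hr⟩ := lin rfl
    rcases hr.of_pos rfl with ⟨rfl, q, G, P, b, rfl⟩ | ⟨rfl, q, b, rfl⟩
    · exact ⟨_, _, _, .bang hc⟩
    · exact ⟨_, _, _, .bangC hc⟩
  | bot =>
    obtain ⟨r, H', c, rfl, hc, hr⟩ := lin rfl
    cases hr with
    | write h => cases h
    | writeC h => cases h
    | bot => exact ⟨_, _, _, .bot hc⟩
    | botC => exact ⟨_, _, _, .botC hc⟩
  | whynot =>
    obtain ⟨r, H', c, rfl, hc, hr⟩ := lin rfl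
    cases hr with
    | write h => cases h
    | writeC h => cases h
    | whynot => exact ⟨_, _, _, .whynot hc⟩
    | whynotC => exact ⟨_, _, _, .whynotC hc⟩
  | amp =>
    obtain ⟨r, H', c, rfl, hc, hr⟩ := lin rfl
    cases hr with
    | write h => cases h
    | writeC h => cases h
    | amp hl => exact ⟨_, _, _, .amp hl hc⟩
    | ampC hl => exact ⟨_, _, _, .ampC hl hc⟩
  | @par _ _ _ A =>
    obtain ⟨r, H', c, rfl, hc, hr⟩ := lin rfl
    obtain ⟨e, f, hef⟩ := exists_new (r ::ₘ H')
    cases hr with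
    | write h => cases h
    | writeC h => cases h
    | par =>
      cases A.pol with
      | pos => exact ⟨_, _, _, .parPos hc hef⟩
      | neg => exact ⟨_, _, _, .parNeg hc hef⟩
    | parC =>
      cases A.pol with
      | pos => exact ⟨_, _, _, .parPosC hc hef⟩
      | neg => exact ⟨_, _, _, .parNegC hc hef⟩
  | @call _ _ _ A _ _ hx =>
    obtain ⟨z, F, R, hv⟩ := hE.unr _ _ hx
    obtain ⟨e, f, hef⟩ := exists_new H
    cases A.pol with
    | pos => exact ⟨_, _, _, .callPos hv hef⟩
    | neg => exact ⟨_, _, _, .callNeg hv hef⟩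

/-! ### Progress -/

theorem CutStep.heap_subset {E P H E' P' H'} (h : CutStep E P H E' P' H') : H ⊆ H' := by
  cases h with
  | unr => exact fun _ h => h
  | _ => exact Multiset.subset_cons _ _

/-- Static constructs never change or remove a record, so a record that makes a session ready
survives while other threads are encoded. -/
theorem Encode.heap_subset {S C : State} (h : Encode S C) : S.2 ⊆ C.2 := by
  induction h with
  | nil => exact fun _ h => h
  | act _ _ ih => exact ih
  | zero _ ih => exact ih
  | mix _ ih => exact ih
  | pcut _ _ ih => exact Multiset.Subset.trans (Multiset.subset_cons _ _) ih
  | cut hs _ ih => exact Multiset.Subset.trans hs.heap_subset ih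

theorem New.seq_notMem {H : Heap} {a b : Ref} (h : New H a b) (q : List MVal) (G : Env)
    (P : Proc) : Rec.seq a q G P b ∉ H := fun hm => (h.2 _ hm).1 (.inl rfl)

theorem New.conc_notMem {H : Heap} {a b : Ref} (h : New H a b) (q : List MVal) :
    Rec.conc a q b ∉ H := fun hm => (h.2 _ hm).1 (.inl rfl)

/-- An empty queue fits only a positive writer, and a lone tick or unrestricted closure fits only a
void one. What remains has a closure or a label at its head. -/
theorem Fits.ready_seq {B A q} (h : Fits B (some A) q) (hA : A.pol = .neg) (E G : Env) (P : Proc)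
    (a b : Ref) : Ready .seq B b (.seq a (q.map (QVal.load E)) G P b) := by
  cases h with
  | nil hp => simp [hA] at hp
  | clos => exact .par
  | lab hl => exact .amp hl

theorem Fits.ready_void {B q} (h : Fits B none q) (E : Env) (a b : Ref) :
    Ready .seq B b (.seq a (q.map (QVal.load E)) Env.empty .zero b) := by
  cases h with
  | tick => exact .bot
  | closB => exact .whynot
  | clos => exact .par
  | lab hl => exact .amp hl

theorem Fits.ready_conc {B A q} (h : Fits B A q) (hA : ∀ A', A = some A' → A'.pol = .neg)
    (E : Env) (a b : Ref) : Ready .conc B b (.conc a (q.map (QVal.load E)) b) := by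
  cases h with
  | nil hp => simp [hA _ rfl] at hp
  | tick => exact .botC
  | closB => exact .whynotC
  | clos => exact .parC
  | lab hl => exact .ampC hl

section

variable {κ : Mode} {x y : Name} {A : Option Ty} {q : List (QVal Proc)} {B : Ty} {P Q : Proc}
  {Δ : LinCtx} {Γ : UnrCtx} {E : Env} {H : Heap} {ρ : Name → Rec} {r : Rec} {c : Ref}

/-- The reader of a cut is live and, if its session is ready, has a ready environment. -/
theorem CutInv.ready_reader (I : CutInv κ x A q y B P Q Δ Γ) (hE : EnvReady E Δ Γ H ρ)
    (hr : Ready κ B c r) (hnew : r ∉ H) :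
    Live Q ∧ ∃ Δ' ρ', Typed Q Δ' Γ ∧ EnvReady (E.setRef y c) Δ' Γ (r ::ₘ H) ρ' := by
  obtain ⟨Δ₂, hs, -, hQ⟩ := I.reader
  exact ⟨hQ.live (n := y) (by simp [Ctx.cons_self]), _, _, hQ,
    (hE.mono hs fun _ h => h).cons I.freshRead hr hnew⟩

/-- The writer of a cut is live and, if its session is ready, has a ready environment. -/
theorem CutInv.ready_writer {A' : Ty} (I : CutInv κ x (some A') q y B P Q Δ Γ)
    (hE : EnvReady E Δ Γ H ρ) (hr : Ready κ A' c r) (hnew : r ∉ H) :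
    Live P ∧ ∃ Δ' ρ', Typed P Δ' Γ ∧ EnvReady (E.setRef x c) Δ' Γ (r ::ₘ H) ρ' := by
  obtain ⟨Δ₁, hs, -, hP⟩ := I.writer _ rfl
  exact ⟨hP.live (n := x) (by simp [Ctx.cons_self]), _, _, hP,
    (hE.mono hs fun _ h => h).cons I.freshWrite hr hnew⟩

end

/-- A live typed thread all of whose sessions are ready leads, in the encoded state, to a thread
that has a transition. -/
theorem Encode.exists_fires {S C : State} (h : Encode S C) :
    ∀ E P, (E, P) ∈ S.1 → ∀ Δ Γ ρ, Typed P Δ Γ → EnvReady E Δ Γ S.2 ρ → Live P →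
      ∃ E' P', (E', P') ∈ C.1 ∧ Fires E' P' C.2 := by
  have refl : ∀ Δ : LinCtx, Δ.Sub Δ := fun _ _ _ h => h
  induction h with
  | nil => simp
  | act hA h ih =>
    intro F P hm Δ Γ ρ hP hE hl
    rcases Multiset.mem_cons.1 hm with he | hm
    · cases he
      exact ⟨_, _, Multiset.mem_cons_self _ _, hP.fires hA (hE.mono (refl _) h.heap_subset)⟩
    · obtain ⟨E', P', hm', hf⟩ := ih F P hm Δ Γ ρ hP hE hl
      exact ⟨E', P', Multiset.mem_cons_of_mem hm', hf⟩
  | zero h ih =>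
    intro F P hm Δ Γ ρ hP hE hl
    rcases Multiset.mem_cons.1 hm with he | hm
    · cases he
      -- Inaction is not live, so the followed thread is never deleted.
      cases hl with
      | act h => cases h
    · exact ih F P hm Δ Γ ρ hP hE hl
  | mix h ih =>
    intro F P hm Δ Γ ρ hP hE hl
    rcases Multiset.mem_cons.1 hm with he | hm
    · cases he
      cases hP with
      | mix hP hQ hd =>
        cases hl with
        | act h => cases h
        | mixL hl =>
          exact ih _ _ (by simp) _ _ ρ hP (hE.mono (Ctx.sub_union_left _ _) fun _ h => h) hl
        | mixR hl =>
          exact ih _ _ (by simp) _ _ ρ hQ (hE.mono (Ctx.sub_union_right hd) fun _ h => h) hl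
    · exact ih F P (by simp [hm]) Δ Γ ρ hP hE hl
  | @pcut E x A q y B P Q T H C a b hab h ih =>
    intro F P' hm Δ Γ ρ hP hE hl
    rcases Multiset.mem_cons.1 hm with he | hm
    · cases he
      have I := hP.cut_inv
      -- Both sides become threads here, and polarity selects the one to follow: a positive writer,
      -- otherwise the reader.
      by_cases hA : ∃ A', A = some A' ∧ A'.pol = .pos
      · obtain ⟨A', rfl, hA⟩ := hA
        obtain ⟨hl', Δ', ρ', hT, hE'⟩ := I.ready_writer hE (.writeC hA) (hab.conc_notMem _)
        exact ih _ _ (by simp) _ _ _ hT hE' hl'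
      · have hA' : ∀ A', A = some A' → A'.pol = .neg := fun A' h => by
          cases hp : A'.pol with
          | pos => exact absurd ⟨A', h, hp⟩ hA
          | neg => rfl
        obtain ⟨hl', Δ', ρ', hT, hE'⟩ :=
          I.ready_reader hE (I.fits.ready_conc hA' _ _ _) (hab.conc_notMem _)
        exact ih _ _ (by simp) _ _ _ hT hE' hl'
    · exact ih F P' (by simp [hm]) Δ Γ ρ hP (hE.mono (refl _) (Multiset.subset_cons _ _)) hl
  | cut hs h ih =>
    intro F P' hm Δ Γ ρ hP hE hl
    rcases Multiset.mem_cons.1 hm with he | hm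
    · cases he
      cases hs with
      | pos hab hA =>
        obtain ⟨hl', Δ', ρ', hT, hE'⟩ :=
          hP.cut_inv.ready_writer hE (.write hA) (hab.seq_notMem _ _ _)
        exact ih _ _ (by simp) _ _ _ hT hE' hl'
      | neg hab hA =>
        obtain ⟨hl', Δ', ρ', hT, hE'⟩ := hP.cut_inv.ready_reader hE
          (hP.cut_inv.fits.ready_seq hA _ _ _ _ _) (hab.seq_notMem _ _ _)
        exact ih _ _ (by simp) _ _ _ hT hE' hl'
      | void hab =>
        obtain ⟨hl', Δ', ρ', hT, hE'⟩ := hP.cut_inv.ready_reader hE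
          (hP.cut_inv.fits.ready_void _ _ _) (hab.seq_notMem _ _ _)
        exact ih _ _ (by simp) _ _ _ hT hE' hl'
      | unr =>
        cases hl with
        | act h => cases h
        | cutB hl =>
          cases hP with
          -- No linear session is created, so liveness of the client comes from the hypothesis; the
          -- server closure supplies the new unrestricted name.
          | cutB _ hQ _ hx _ =>
            exact ih _ _ (Multiset.mem_cons_self _ _) _ _ _ hQ (hE.consUnr hx _ _ _ _) hl
    · exact ih F P' (by simp [hm]) Δ Γ ρ hP (hE.mono (refl _) hs.heap_subset) hl

end SAM

theorem mainTheorem10 (P : SAM.Proc)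
    (htyped : SAM.Typed P SAM.Ctx.empty SAM.Ctx.empty) (hlive : SAM.Live P) :
    (∃ S : SAM.State, SAM.EncC P S) ∧
      ∀ S : SAM.State, SAM.EncC P S → ∃ C : SAM.State, SAM.Step S C := by
  constructor
  · exact htyped.encodable SAM.Env.empty (T := 0) (fun _ => ⟨_, .nil⟩) 0
  · rintro ⟨T, H⟩ hS
    obtain ⟨E, A, hm, E', P', H', hstep⟩ := SAM.Encode.exists_fires hS SAM.Env.empty P
      -- The linear context is empty, so the assignment of records is arbitrary and readiness is
      -- vacuous.
      (Multiset.mem_singleton_self _) _ _ (fun _ => .conc 0 [] 0) htyped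
      ⟨nofun, nofun, fun _ _ _ h => absurd rfl h⟩ hlive
    obtain ⟨T', rfl⟩ := Multiset.exists_cons_of_mem hm
    exact ⟨_, .run hstep⟩
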